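/- Let $G$ be a discrete group generated by a finite set $S$, let $l_S$ be the word length on $G$ with respect to $S\cup S^{-1}$, and let $A$ be a subgroup of $G$. An element $a\in G$ is called undistorted (in $G$) if $l_S(a^n)$ grows linearly in $n$, that is, there are constants $0<c\le C$ with $cn\le l_S(a^n)\le Cn$ for all sufficiently large $n$; otherwise $a$ is called distorted. The pair $(G,A)$ has relative property $F\mathbb{E}$ if for every $n\ge 0$ every isometric action of $G$ on the Euclidean space $\mathbb{E}^n$ has an $A$-fixed point. For a unitary representation $\pi$ of $G$ on a separable complex Hilbert space $\mathcal H$ let $Z^1(G,\pi)=\{b:G\to\mathcal H \mid b(gh)=b(g)+\pi(g)b(h)\ \forall g,h\in G\}$ with the topology of pointwise convergence (which is uniform convergence on compact subsets of the discrete group $G$), let $B^1(G,\pi)$ be the subspace of the maps $g\mapsto \pi(g)v-v$ with $v\in\mathcal H$, and let $\overline{H}^1(G,\pi)=Z^1(G,\pi)/\overline{B^1(G,\pi)}$. The pair $(G,A)$ has weak relative $(H_T)$ if every such $\pi$ for which the restriction map $\overline{H}^1(G,\pi)\to\overline{H}^1(A,\pi|_A)$ is non-zero has a non-zero $A$-invariant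 vector. Each of the following two conditions implies that $(G,A)$ has relative property $F\mathbb{E}$: 1. $A$ is boundedly generated by finitely many elements that are distorted in $G$, i.e. there are finitely many $a_1,\dots,a_k\in A$, each distorted in $G$, with $A=\langle a_1\rangle\cdots\langle a_k\rangle$. 2. $A$ is a normal subgroup of $G$, $(G,A)$ has weak relative $(H_T)$, and $A$ is generated by elements that are distorted in $G$. -/

import Mathlib

/-! Notions for a discrete group `G` and a subgroup `A`. Since `G` is discrete, all maps on `G` are
continuous, compact subsets of `G` are finite, and uniform convergence on compact subsets of `G` is
pointwise convergence, i.e. convergence in the product topology of `G → H`. -/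

namespace RelFE

section Length

variable {G : Type*} [Group G]

/-- The word length of `g` with respect to `S`: the least length of a word in letters from
`S ∪ S⁻¹` whose product is `g`. -/
noncomputable def wordLength (S : Set G) (g : G) : ℕ :=
  sInf {n | ∃ l : List G, (∀ x ∈ l, x ∈ S ∨ x⁻¹ ∈ S) ∧ l.prod = g ∧ l.length = n}

/-- `a` is undistorted if the word length of `a ^ n` grows linearly in `n`. -/
def IsUndistorted (S : Set G) (a : G) : Prop :=
  Asymptotics.IsTheta Filter.atTop
    (fun n : ℕ => (wordLength S (a ^ n) : ℝ)) (fun n : ℕ => (n : ℝ))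

/-- `a` is distorted if it is not undistorted. -/
def IsDistorted (S : Set G) (a : G) : Prop := ¬ IsUndistorted S a

open scoped Pointwise in
/-- `A = ⟨a₁⟩ ⋯ ⟨aₖ⟩` for finitely many `a₁, …, aₖ ∈ A` that are distorted in `G`. -/
def BoundedlyGeneratedByDistorted (S : Set G) (A : Subgroup G) : Prop :=
  ∃ L : List G, (∀ a ∈ L, a ∈ A ∧ IsDistorted S a) ∧
    (A : Set G) = (L.map fun a => (Subgroup.zpowers a : Set G)).prod

/-- `A` is generated, as a group, by some set of elements that are distorted in `G`. -/
def GeneratedByDistorted (S : Set G) (A : Subgroup G) : Prop :=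
  ∃ T : Set G, (∀ a ∈ T, IsDistorted S a) ∧ Subgroup.closure T = A

/-- `(G, A)` has relative property `FE`: every action of `G` by isometries on a Euclidean space
`ℝⁿ` has a point that is fixed by `A`. -/
def HasRelativeFE (A : Subgroup G) : Prop :=
  ∀ (n : ℕ) (α : G →* (EuclideanSpace ℝ (Fin n) ≃ᵢ EuclideanSpace ℝ (Fin n))),
    ∃ x : EuclideanSpace ℝ (Fin n), ∀ a ∈ A, α a x = x

end Length

section Cohomology

variable {G : Type*} [Group G] {H : Type*} [NormedAddCommGroup H] [InnerProductSpace ℂ H]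

/-- The space `Z¹(G, π)` of 1-cocycles of a unitary representation `π`. -/
def cocycles (π : G →* (H ≃ₗᵢ[ℂ] H)) : Submodule ℂ (G → H) where
  carrier := {b | ∀ g h, b (g * h) = b g + π g (b h)}
  zero_mem' := by intro g h; simp
  add_mem' := by
    intro b c hb hc g h
    simp only [Pi.add_apply, hb g h, hc g h, map_add]
    abel
  smul_mem' := by
    intro z b hb g h
    simp only [Pi.smul_apply, hb g h, map_smul, smul_add]

/-- The space `B¹(G, π)` of 1-coboundaries, as a subspace of `Z¹(G, π)`. -/
def coboundaries (π : G →* (H ≃ₗᵢ[ℂ] H)) : Submodule ℂ (cocycles π) where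
  carrier := {b | ∃ v : H, ∀ g, b.1 g = π g v - v}
  zero_mem' := ⟨0, by intro g; simp⟩
  add_mem' := by
    rintro b c ⟨v, hv⟩ ⟨w, hw⟩
    refine ⟨v + w, fun g => ?_⟩
    simp only [Submodule.coe_add, Pi.add_apply, hv g, hw g, map_add]
    abel
  smul_mem' := by
    rintro z b ⟨v, hv⟩
    refine ⟨z • v, fun g => ?_⟩
    simp only [Submodule.coe_smul, Pi.smul_apply, hv g, map_smul, smul_sub]

/-- The reduced cohomology `Z¹(G, π) / closure B¹(G, π)`, where `Z¹(G, π)` carries the topology of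
pointwise convergence. -/
abbrev ReducedH1 (π : G →* (H ≃ₗᵢ[ℂ] H)) : Type _ :=
  cocycles π ⧸ (coboundaries π).topologicalClosure

/-- The restriction `π|_A` of a representation to a subgroup. -/
def restrictRep (A : Subgroup G) (π : G →* (H ≃ₗᵢ[ℂ] H)) : A →* (H ≃ₗᵢ[ℂ] H) :=
  π.comp A.subtype

/-- Restriction of cocycles to a subgroup. -/
def restrictCocycle (A : Subgroup G) (π : G →* (H ≃ₗᵢ[ℂ] H)) :
    cocycles π →ₗ[ℂ] cocycles (restrictRep A π) where
  toFun b := ⟨fun a => b.1 a, fun a a' => b.2 a a'⟩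
  map_add' _ _ := rfl
  map_smul' _ _ := rfl

theorem continuous_restrictCocycle (A : Subgroup G) (π : G →* (H ≃ₗᵢ[ℂ] H)) :
    Continuous (restrictCocycle A π) := by
  refine continuous_induced_rng.2 (continuous_pi fun a => ?_)
  exact (continuous_apply (a : G)).comp continuous_subtype_val

theorem closure_le_comap_restrictCocycle (A : Subgroup G) (π : G →* (H ≃ₗᵢ[ℂ] H)) :
    (coboundaries π).topologicalClosure ≤
      (coboundaries (restrictRep A π)).topologicalClosure.comap (restrictCocycle A π) := by
  refine Submodule.topologicalClosure_minimal _ ?_ ?_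
  · rintro b ⟨v, hv⟩
    exact Submodule.le_topologicalClosure _ ⟨v, fun a => hv a⟩
  · exact (Submodule.isClosed_topologicalClosure _).preimage (continuous_restrictCocycle A π)

/-- The restriction map from the reduced cohomology of `(G, π)` to that of `(A, π|_A)`. -/
def reducedRestriction (A : Subgroup G) (π : G →* (H ≃ₗᵢ[ℂ] H)) :
    ReducedH1 π →ₗ[ℂ] ReducedH1 (restrictRep A π) :=
  Submodule.mapQ _ _ (restrictCocycle A π) (closure_le_comap_restrictCocycle A π)

end Cohomology

/-- `(G, A)` has weak relative `(H_T)`: every unitary representation `π` of `G` on a separable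
complex Hilbert space for which the restriction map on reduced first cohomology is non-zero has a
non-zero `A`-invariant vector. Every separable Hilbert space is isomorphic to one in `Type`. -/
def HasWeakRelativeHT {G : Type*} [Group G] (A : Subgroup G) : Prop :=
  ∀ (H : Type) [NormedAddCommGroup H] [InnerProductSpace ℂ H] [CompleteSpace H]
    [TopologicalSpace.SeparableSpace H] (π : G →* (H ≃ₗᵢ[ℂ] H)),
    reducedRestriction A π ≠ 0 → ∃ v : H, v ≠ 0 ∧ ∀ a ∈ A, π a v = v

end RelFE

/-! An isometric action on a Euclidean space has the form `x ↦ π g x + b g` with `π` orthogonal and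
`b` a cocycle. Such a `b` is bounded by a multiple of the word length, so along the powers of a
distorted element `‖b (a ^ n)‖ ≤ c * n` infinitely often, for each `c > 0`. In finite dimension `b a
= π a v - v + w` with `π a w = w`, hence `b (a ^ n)` is `n • w` up to a bounded error, and
distortion forces `w = 0` (`IsCocycle.exists_eq_sub_of_frequently`).

Condition 1: `b` is then bounded on each cyclic factor, so on their finite product `A`, and the
circumcenter of the `A`-orbit of `0` is fixed by `A`.

Condition 2: after complexification, split the space into the `A`-invariants and their orthogonal
complement, both `G`-stable because `A` is normal. The invariant component of `b` is a homomorphism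
on `A` that vanishes on distorted generators. The complement has no non-zero `A`-invariant vectors,
so weak relative `(H_T)` kills the reduced class on `A`; coboundaries are closed in finite
dimension, so the class is an honest coboundary there. -/

namespace RelFE

/-! ### Word length and distortion. -/

section WordLength

variable {G : Type*} [Group G]

theorem exists_word_of_closure_eq_top {S : Set G} (hS : Subgroup.closure S = ⊤) (g : G) :
    ∃ l : List G, (∀ x ∈ l, x ∈ S ∨ x⁻¹ ∈ S) ∧ l.prod = g ∧ l.length = wordLength S g := by
  have hne : {n | ∃ l : List G, (∀ x ∈ l, x ∈ S ∨ x⁻¹ ∈ S) ∧ l.prod = g ∧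
      l.length = n}.Nonempty := by
    have hmem : g ∈ (Subgroup.closure S).toSubmonoid := hS ▸ trivial
    rw [Subgroup.closure_toSubmonoid] at hmem
    obtain ⟨l, hl, hg⟩ := Submonoid.exists_list_of_mem_closure hmem
    exact ⟨_, l, hl, hg, rfl⟩
  exact Nat.sInf_mem hne

theorem wordLength_le {S : Set G} {g : G} {l : List G} (hl : ∀ x ∈ l, x ∈ S ∨ x⁻¹ ∈ S)
    (hg : l.prod = g) : wordLength S g ≤ l.length :=
  Nat.sInf_le ⟨l, hl, hg, rfl⟩

theorem wordLength_one (S : Set G) : wordLength S (1 : G) = 0 :=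
  Nat.le_zero.1 (wordLength_le (l := []) (by simp) rfl)

theorem wordLength_mul_le {S : Set G} (hS : Subgroup.closure S = ⊤) (g h : G) :
    wordLength S (g * h) ≤ wordLength S g + wordLength S h := by
  obtain ⟨l, hl, hg, hlen⟩ := exists_word_of_closure_eq_top hS g
  obtain ⟨m, hm, hh, hmen⟩ := exists_word_of_closure_eq_top hS h
  rw [← hlen, ← hmen, ← List.length_append]
  refine wordLength_le (fun x hx => ?_) (by rw [List.prod_append, hg, hh])
  exact (List.mem_append.1 hx).elim (hl x) (hm x)

theorem wordLength_pow_le {S : Set G} (hS : Subgroup.closure S = ⊤) (g : G) (n : ℕ) :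
    wordLength S (g ^ n) ≤ n * wordLength S g := by
  induction n with
  | zero => simp [wordLength_one]
  | succ n ih =>
    rw [pow_succ, add_one_mul]
    exact (wordLength_mul_le hS _ _).trans (Nat.add_le_add_right ih _)

/-- The powers of a distorted element have infinitely often arbitrarily small word length relative
to the exponent. -/
theorem IsDistorted.frequently_mul_wordLength_lt {S : Set G} (hS : Subgroup.closure S = ⊤) {a : G}
    (ha : IsDistorted S a) (C : ℝ) :
    ∃ᶠ n : ℕ in Filter.atTop, C * wordLength S (a ^ n) < n := by
  intro h
  -- The linear upper bound always holds, so distortion can only be a failure of the lower bound.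
  refine ha ⟨Asymptotics.IsBigO.of_bound (wordLength S a) (.of_forall fun n => ?_),
    Asymptotics.IsBigO.of_bound C (h.mono fun n hn => ?_)⟩
  · simp only [Real.norm_natCast]
    rw [mul_comm]
    exact_mod_cast wordLength_pow_le hS a n
  · simpa only [Real.norm_natCast] using not_lt.1 hn

end WordLength

/-! ### Growth of cocycles along distorted elements. -/

section Cocycle

variable {G : Type*} [Group G] {𝕜 : Type*} [RCLike 𝕜]
  {H : Type*} [NormedAddCommGroup H] [InnerProductSpace 𝕜 H]

/-- The cocycle identity over an arbitrary field `ℝ` or `ℂ`. -/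
def IsCocycle (π : G →* (H ≃ₗᵢ[𝕜] H)) (b : G → H) : Prop :=
  ∀ g h, b (g * h) = b g + π g (b h)

variable {π : G →* (H ≃ₗᵢ[𝕜] H)} {b : G → H}

theorem IsCocycle.map_one (hb : IsCocycle π b) : b 1 = 0 := by
  have h := hb 1 1
  simpa using h

theorem IsCocycle.map_inv (hb : IsCocycle π b) (g : G) : b g⁻¹ = -π g⁻¹ (b g) := by
  have h := hb g⁻¹ g
  rw [inv_mul_cancel, hb.map_one] at h
  exact eq_neg_of_add_eq_zero_left h.symm

theorem IsCocycle.norm_inv (hb : IsCocycle π b) (g : G) : ‖b g⁻¹‖ = ‖b g‖ := by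
  rw [hb.map_inv, norm_neg, LinearIsometryEquiv.norm_map]

theorem IsCocycle.norm_mul_le (hb : IsCocycle π b) (g h : G) :
    ‖b (g * h)‖ ≤ ‖b g‖ + ‖b h‖ := by
  rw [hb g h]
  exact (norm_add_le _ _).trans_eq (by rw [LinearIsometryEquiv.norm_map])

theorem IsCocycle.norm_prod_le (hb : IsCocycle π b) {K : ℝ} (l : List G)
    (hl : ∀ x ∈ l, ‖b x‖ ≤ K) : ‖b l.prod‖ ≤ K * l.length := by
  induction l with
  | nil => simp [hb.map_one]
  | cons x l ih =>
    rw [List.prod_cons, List.length_cons]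
    have h1 := hl x (by simp)
    have h2 := ih fun y hy => hl y (by simp [hy])
    have h3 := hb.norm_mul_le x l.prod
    push_cast
    linarith

theorem IsCocycle.exists_norm_le_mul_wordLength (hb : IsCocycle π b) {S : Set G}
    (hfin : S.Finite) (hS : Subgroup.closure S = ⊤) :
    ∃ K : ℝ, ∀ g, ‖b g‖ ≤ K * wordLength S g := by
  obtain ⟨K, hK⟩ := (hfin.image fun s => ‖b s‖).bddAbove
  refine ⟨K, fun g => ?_⟩
  obtain ⟨l, hl, rfl, hlen⟩ := exists_word_of_closure_eq_top hS g
  rw [← hlen]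
  refine hb.norm_prod_le l fun x hx => ?_
  rcases hl x hx with h | h
  · exact hK ⟨x, h, rfl⟩
  · exact (hb.norm_inv x).symm.trans_le (hK ⟨_, h, rfl⟩)

theorem IsCocycle.frequently_norm_pow_le (hb : IsCocycle π b) {S : Set G}
    (hfin : S.Finite) (hS : Subgroup.closure S = ⊤) {a : G} (ha : IsDistorted S a)
    {c : ℝ} (hc : 0 < c) :
    ∃ᶠ n : ℕ in Filter.atTop, ‖b (a ^ n)‖ ≤ c * n := by
  obtain ⟨K, hK⟩ := hb.exists_norm_le_mul_wordLength hfin hS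
  refine (ha.frequently_mul_wordLength_lt hS (K / c)).mono fun n hn => (hK _).trans ?_
  rw [div_mul_eq_mul_div, div_lt_iff₀ hc] at hn
  linarith

/-- A vector whose multiples are, up to a bounded error, infinitely often of arbitrarily small
norm relative to the factor vanishes. -/
theorem eq_zero_of_frequently_mul_norm_le {E : Type*} [NormedAddCommGroup E] {w : E} {M : ℝ}
    (h : ∀ c : ℝ, 0 < c → ∃ᶠ n : ℕ in Filter.atTop, n * ‖w‖ ≤ c * n + M) : w = 0 := by
  by_contra hw
  have hpos : 0 < ‖w‖ / 2 := half_pos (norm_pos_iff.2 hw)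
  have hlarge : ∀ᶠ n : ℕ in Filter.atTop, M < n * (‖w‖ / 2) :=
    (tendsto_natCast_atTop_atTop.atTop_mul_const hpos).eventually_gt_atTop M
  obtain ⟨n, h1, h2⟩ := ((h _ hpos).and_eventually hlarge).exists
  linarith

theorem IsCocycle.pow_eq (hb : IsCocycle π b) {a : G} {v w : H} (hw : π a w = w)
    (ha : b a = π a v - v + w) (n : ℕ) : b (a ^ n) = π (a ^ n) v - v + n • w := by
  induction n with
  | zero => simp [hb.map_one]
  | succ n ih =>
    have hmul : ∀ x, π a (π (a ^ n) x) = π (a ^ (n + 1)) x := fun x => by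
      rw [pow_succ', _root_.map_mul]; rfl
    rw [pow_succ', hb, ih, ha, ← pow_succ', map_add, map_sub, hmul, map_nsmul, hw, succ_nsmul]
    abel

/-- Orthogonality to `U w - w` gives `⟨U w, w⟩ = ‖w‖ ^ 2`; expanding `‖U w - w‖ ^ 2` then gives
zero. -/
theorem eq_of_mem_orthogonal_range_sub (U : H ≃ₗᵢ[𝕜] H) {w : H}
    (hw : w ∈ (LinearMap.range (U.toLinearEquiv.toLinearMap - LinearMap.id))ᗮ) : U w = w := by
  have h : inner 𝕜 (U w - w) w = 0 := hw _ ⟨w, rfl⟩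
  rw [inner_sub_left, sub_eq_zero] at h
  rw [← sub_eq_zero, ← norm_eq_zero, ← sq_eq_zero_iff, @norm_sub_sq 𝕜, U.norm_map, h,
    inner_self_eq_norm_sq]
  ring

/-- A cocycle is trivial on a cyclic subgroup along which it grows sublinearly. -/
theorem IsCocycle.exists_eq_sub_of_frequently [FiniteDimensional 𝕜 H] (hb : IsCocycle π b) {a : G}
    (ha : ∀ c : ℝ, 0 < c → ∃ᶠ n : ℕ in Filter.atTop, ‖b (a ^ n)‖ ≤ c * n) :
    ∃ v, b a = π a v - v := by
  set R := LinearMap.range ((π a).toLinearEquiv.toLinearMap - LinearMap.id)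
  obtain ⟨_, ⟨v, rfl⟩, w, hw, hbw⟩ := R.exists_add_mem_mem_orthogonal (b a)
  have hfix := eq_of_mem_orthogonal_range_sub (π a) hw
  replace hbw : b a = π a v - v + w := hbw
  refine ⟨v, ?_⟩
  rw [hbw, eq_zero_of_frequently_mul_norm_le (w := w) (M := 2 * ‖v‖) fun c hc => ?_, add_zero]
  refine (ha c hc).mono fun n hn => ?_
  have h : n • w = b (a ^ n) - (π (a ^ n) v - v) := by rw [hb.pow_eq hfix hbw]; abel
  calc (n : ℝ) * ‖w‖ = ‖n • w‖ := by rw [← Nat.cast_smul_eq_nsmul 𝕜, norm_smul]; simp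
    _ ≤ ‖b (a ^ n)‖ + (‖π (a ^ n) v‖ + ‖v‖) := by
      rw [h]; exact (norm_sub_le _ _).trans (add_le_add_right (norm_sub_le _ _) _)
    _ ≤ c * n + 2 * ‖v‖ := by rw [LinearIsometryEquiv.norm_map]; linarith

theorem IsCocycle.norm_zpow_le (hb : IsCocycle π b) {a : G} {v : H} (ha : b a = π a v - v)
    (k : ℤ) : ‖b (a ^ k)‖ ≤ 2 * ‖v‖ := by
  have hnat : ∀ n : ℕ, ‖b (a ^ n)‖ ≤ 2 * ‖v‖ := fun n => by
    rw [hb.pow_eq (w := 0) (map_zero _) (by rw [ha, add_zero]), smul_zero, add_zero, two_mul]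
    exact (norm_sub_le _ _).trans_eq (by rw [LinearIsometryEquiv.norm_map])
  obtain ⟨n, rfl | rfl⟩ := k.eq_nat_or_neg
  · simpa using hnat n
  · rw [zpow_neg, hb.norm_inv]
    simpa using hnat n

open scoped Pointwise in
theorem IsCocycle.bounded_of_boundedlyGenerated (hb : IsCocycle π b) (L : List G)
    (hL : ∀ a ∈ L, ∃ v, b a = π a v - v) :
    ∃ M : ℝ, ∀ g ∈ (L.map fun a => (Subgroup.zpowers a : Set G)).prod, ‖b g‖ ≤ M := by
  induction L with
  | nil => exact ⟨0, fun g hg => by simp_all [hb.map_one]⟩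
  | cons a L ih =>
    obtain ⟨M, hM⟩ := ih fun x hx => hL x (by simp [hx])
    obtain ⟨v, hv⟩ := hL a (by simp)
    refine ⟨2 * ‖v‖ + M, fun g hg => ?_⟩
    rw [List.map_cons, List.prod_cons] at hg
    obtain ⟨_, ⟨k, rfl⟩, y, hy, rfl⟩ := hg
    exact (hb.norm_mul_le _ _).trans (add_le_add (hb.norm_zpow_le hv k) (hM y hy))

end Cocycle

/-! ### Circumcenters of bounded sets. -/

section Circumcenter

variable {E : Type*} [NormedAddCommGroup E] [InnerProductSpace ℝ E] [FiniteDimensional ℝ E]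

/-- A nonempty bounded set has a circumcenter, which is fixed by all isometries that preserve the
set. -/
theorem exists_fixed_of_bounded {s : Set E} (hne : s.Nonempty) (hs : Bornology.IsBounded s) :
    ∃ x : E, ∀ f : E ≃ᵢ E, f '' s = s → f x = x := by
  have : ProperSpace E := FiniteDimensional.proper_real E
  obtain ⟨y₀, hy₀⟩ := hne
  obtain ⟨R, hR⟩ := hs.subset_closedBall y₀
  -- Pairs (center, radius) of closed balls containing `s`; the circumcenter comes from minimising
  -- the radius.
  let K : Set (E × ℝ) := {p | ∀ y ∈ s, dist y p.1 ≤ p.2}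
  have hKclosed : IsClosed K := by
    simp only [K, Set.ofPred_forall]
    exact isClosed_biInter fun y _ => isClosed_le (by fun_prop) (by fun_prop)
  have hcomp : IsCompact (K ∩ Metric.closedBall y₀ R ×ˢ Set.Icc 0 R) :=
    ((isCompact_closedBall y₀ R).prod isCompact_Icc).inter_left hKclosed
  have hy₀K : ∀ y ∈ s, dist y y₀ ≤ R := fun y hy => hR hy
  have hR0 : 0 ≤ R := dist_nonneg.trans (hy₀K y₀ hy₀)
  obtain ⟨⟨x, ρ⟩, ⟨hxK, hx⟩, hmin⟩ := hcomp.exists_isMinOn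
    ⟨(y₀, R), hy₀K, Metric.mem_closedBall_self hR0, hR0, le_rfl⟩ continuousOn_snd
  have hρ0 : 0 ≤ ρ := hx.2.1
  have hρR : ρ ≤ R := hx.2.2
  -- Cutting `K` down to a compact set loses nothing: a ball around `z` of radius `σ < ρ ≤ R`
  -- containing `s` contains `y₀`, so `z` lies within `R` of `y₀`.
  have hle : ∀ z σ, (∀ y ∈ s, dist y z ≤ σ) → ρ ≤ σ := fun z σ hz => by
    by_contra! hlt
    have h0 : dist y₀ z ≤ σ := hz y₀ hy₀
    have : ρ ≤ σ := hmin (show (z, σ) ∈ _ from ⟨hz, by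
      rw [Metric.mem_closedBall, dist_comm]; linarith, dist_nonneg.trans h0, by
      show σ ≤ R
      linarith⟩)
    linarith
  -- By the parallelogram law, two distinct optimal centers would make their midpoint the center of
  -- a smaller ball.
  have huniq : ∀ z, (∀ y ∈ s, dist y z ≤ ρ) → z = x := fun z hz => by
    have hmid : ∀ y ∈ s, dist y ((1 / 2 : ℝ) • (x + z)) ≤ √(ρ ^ 2 - ‖z - x‖ ^ 2 / 4) :=
      fun y hy => by
        refine Real.le_sqrt_of_sq_le ?_
        have hpar := parallelogram_law_with_norm ℝ (y - x) (y - z)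
        have h1 : y - x + (y - z) = (2 : ℝ) • (y - (1 / 2 : ℝ) • (x + z)) := by module
        have h2 : y - x - (y - z) = z - x := by abel
        have hx' : ‖y - x‖ ≤ ρ := (dist_eq_norm y x).symm.trans_le (hxK y hy)
        have hz' : ‖y - z‖ ≤ ρ := (dist_eq_norm y z).symm.trans_le (hz y hy)
        rw [h1, h2, norm_smul, Real.norm_ofNat] at hpar
        rw [dist_eq_norm]
        have := pow_le_pow_left₀ (norm_nonneg _) hx' 2
        have := pow_le_pow_left₀ (norm_nonneg _) hz' 2
        nlinarith
    have hρ := hle _ _ hmid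
    -- A negative radicand would make `√` equal to `0`, hence `ρ = 0` and `x = y₀ = z`, which is
    -- absurd.
    have hnonneg : 0 ≤ ρ ^ 2 - ‖z - x‖ ^ 2 / 4 := by
      by_contra! hlt
      rw [Real.sqrt_eq_zero_of_nonpos hlt.le] at hρ
      have h0 : ρ = 0 := le_antisymm hρ hρ0
      have hx' : dist y₀ x ≤ ρ := hxK y₀ hy₀
      have hz' := hz y₀ hy₀
      rw [h0] at hx' hz'
      rw [← dist_le_zero.1 hx', ← dist_le_zero.1 hz', h0] at hlt
      simp at hlt
    have hsq := (Real.le_sqrt hρ0 hnonneg).1 hρ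
    have hzero : ‖z - x‖ ^ 2 = 0 := le_antisymm (by linarith) (sq_nonneg _)
    exact sub_eq_zero.1 (norm_eq_zero.1 (sq_eq_zero_iff.1 hzero))
  refine ⟨x, fun f hf => huniq _ fun y hy => ?_⟩
  rw [← hf] at hy
  obtain ⟨y, hy, rfl⟩ := hy
  rw [f.dist_eq]
  exact hxK y hy

end Circumcenter

/-! ### Isometric actions as affine actions; the first condition. -/

section AffineAction

variable {G : Type*} [Group G] {E : Type*} [NormedAddCommGroup E] [InnerProductSpace ℝ E]

/-- The linear part of an isometric action. -/
noncomputable def linearPart (α : G →* (E ≃ᵢ E)) : G →* (E ≃ₗᵢ[ℝ] E) :=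
  MonoidHom.mk' (fun g => (α g).toRealLinearIsometryEquiv) fun g h => by
    ext x
    show (α (g * h)).toRealLinearIsometryEquiv x =
      (α g).toRealLinearIsometryEquiv ((α h).toRealLinearIsometryEquiv x)
    rw [(α h).toRealLinearIsometryEquiv_apply, map_sub]
    simp only [IsometryEquiv.toRealLinearIsometryEquiv_apply, map_mul, IsometryEquiv.mul_apply]
    abel

theorem action_apply (α : G →* (E ≃ᵢ E)) (g : G) (x : E) : α g x = α g 0 + linearPart α g x := by
  show α g x = α g 0 + (α g).toRealLinearIsometryEquiv x
  rw [IsometryEquiv.toRealLinearIsometryEquiv_apply]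
  abel

theorem isCocycle_orbit (α : G →* (E ≃ᵢ E)) : IsCocycle (linearPart α) fun g => α g 0 :=
  fun g h => by
    show α (g * h) 0 = _
    rw [← action_apply, map_mul]
    rfl

theorem exists_fixed_of_orbit_bounded [FiniteDimensional ℝ E] (α : G →* (E ≃ᵢ E)) (A : Subgroup G)
    {M : ℝ} (hM : ∀ a ∈ A, ‖α a 0‖ ≤ M) : ∃ x : E, ∀ a ∈ A, α a x = x := by
  obtain ⟨x, hx⟩ := exists_fixed_of_bounded (s := (fun a => α a 0) '' (A : Set G))
    ⟨_, 1, A.one_mem, rfl⟩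
    (isBounded_iff_forall_norm_le.2 ⟨M, by rintro _ ⟨a, ha, rfl⟩; exact hM a ha⟩)
  refine ⟨x, fun a ha => hx _ ?_⟩
  ext y
  constructor
  · rintro ⟨_, ⟨c, hc, rfl⟩, rfl⟩
    exact ⟨a * c, A.mul_mem ha hc, by show α (a * c) 0 = _; rw [map_mul]; rfl⟩
  · rintro ⟨c, hc, rfl⟩
    refine ⟨_, ⟨a⁻¹ * c, A.mul_mem (A.inv_mem ha) hc, rfl⟩, ?_⟩
    show (α a * α (a⁻¹ * c)) 0 = _
    rw [← map_mul, mul_inv_cancel_left]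

theorem hasRelativeFE_of_boundedlyGeneratedByDistorted {S : Set G} (hfin : S.Finite)
    (hS : Subgroup.closure S = ⊤) {A : Subgroup G} (hA : BoundedlyGeneratedByDistorted S A) :
    HasRelativeFE A := by
  obtain ⟨L, hL, hprod⟩ := hA
  intro n α
  have hb := isCocycle_orbit α
  obtain ⟨M, hM⟩ := hb.bounded_of_boundedlyGenerated L fun a ha =>
    hb.exists_eq_sub_of_frequently fun c hc => hb.frequently_norm_pow_le hfin hS (hL a ha).2 hc
  rw [← hprod] at hM
  exact exists_fixed_of_orbit_bounded α A hM

end AffineAction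

/-! ### Invariant vectors, closed coboundaries and weak relative `(H_T)`. -/

section Invariants

variable {G : Type*} [Group G] {H : Type*} [NormedAddCommGroup H] [InnerProductSpace ℂ H]

/-- The subspace of `A`-invariant vectors. -/
def invariants (A : Subgroup G) (π : G →* (H ≃ₗᵢ[ℂ] H)) : Submodule ℂ H where
  carrier := {v | ∀ a ∈ A, π a v = v}
  zero_mem' := by intro a _; simp
  add_mem' := by
    intro v w hv hw a ha
    rw [map_add, hv a ha, hw a ha]
  smul_mem' := by
    intro z v hv a ha
    rw [map_smul, hv a ha]

theorem map_mem_invariants {A : Subgroup G} (hA : A.Normal) (π : G →* (H ≃ₗᵢ[ℂ] H)) (g : G) {v : H}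
    (hv : v ∈ invariants A π) : π g v ∈ invariants A π := fun a ha => by
  have h := hv (g⁻¹ * a * g) (by simpa using hA.conj_mem a ha g⁻¹)
  calc π a (π g v) = π (a * g) v := by rw [map_mul]; rfl
    _ = π (g * (g⁻¹ * a * g)) v := by congr 2; group
    _ = π g v := by rw [map_mul]; exact congrArg (π g) h

theorem inner_map_left (π : G →* (H ≃ₗᵢ[ℂ] H)) (g : G) (v w : H) :
    inner ℂ v (π g w) = inner ℂ (π g⁻¹ v) w := by
  rw [← (π g).inner_map_map (π g⁻¹ v) w]
  congr 1
  show v = (π g * π g⁻¹) v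
  rw [← map_mul, mul_inv_cancel, map_one]
  rfl

theorem map_mem_orthogonal {W : Submodule ℂ H} {π : G →* (H ≃ₗᵢ[ℂ] H)}
    (hW : ∀ g, ∀ v ∈ W, π g v ∈ W) (g : G) {v : H} (hv : v ∈ Wᗮ) : π g v ∈ Wᗮ := fun w hw => by
  rw [inner_map_left]
  exact hv _ (hW _ _ hw)

/-- The restriction of a unitary representation to an invariant subspace. -/
def subRep (W : Submodule ℂ H) (π : G →* (H ≃ₗᵢ[ℂ] H)) (hW : ∀ g, ∀ v ∈ W, π g v ∈ W) :
    G →* (W ≃ₗᵢ[ℂ] W) :=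
  MonoidHom.mk' (fun g =>
    { toFun := fun v => ⟨π g v, hW g v v.2⟩
      invFun := fun v => ⟨π g⁻¹ v, hW g⁻¹ v v.2⟩
      map_add' := fun v w => Subtype.ext (map_add (π g) v.1 w.1)
      map_smul' := fun z v => Subtype.ext (map_smul (π g) z v.1)
      left_inv := fun v => Subtype.ext (by simp)
      right_inv := fun v => Subtype.ext (by simp)
      norm_map' := fun v => (π g).norm_map v })
    fun g h => by ext v; exact congrArg (fun U : H ≃ₗᵢ[ℂ] H => U v) (map_mul π g h)

/-- The coboundaries are the image of the finite-dimensional space `H` under a linear map. -/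
theorem isClosed_coboundaries [FiniteDimensional ℂ H] (π : G →* (H ≃ₗᵢ[ℂ] H)) :
    IsClosed (coboundaries π : Set (cocycles π)) := by
  let d : H →ₗ[ℂ] cocycles π :=
    { toFun := fun v => ⟨fun g => π g v - v, fun g h => by
        have hmul : π (g * h) v = π g (π h v) := by rw [map_mul]; rfl
        simp only [hmul, map_sub]
        abel⟩
      map_add' := fun v w => Subtype.ext (funext fun g => by simp; abel)
      map_smul' := fun z v => Subtype.ext (funext fun g => by simp [smul_sub]) }
  have h : coboundaries π = LinearMap.range d := by
    ext b
    constructor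
    · rintro ⟨v, hv⟩
      exact ⟨v, Subtype.ext (funext fun g => (hv g).symm)⟩
    · rintro ⟨v, rfl⟩
      exact ⟨v, fun g => rfl⟩
  rw [h]
  exact Submodule.closed_of_finiteDimensional _

/-- In finite dimension, if there are no nonzero `A`-invariant vectors, weak relative `(H_T)` makes
every cocycle trivial on `A`. -/
theorem HasWeakRelativeHT.exists_eq_sub {A : Subgroup G} (hA : HasWeakRelativeHT A) {V : Type}
    [NormedAddCommGroup V] [InnerProductSpace ℂ V] [FiniteDimensional ℂ V]
    (π : G →* (V ≃ₗᵢ[ℂ] V)) (hinv : ∀ v, (∀ a ∈ A, π a v = v) → v = 0) {b : G → V}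
    (hb : IsCocycle π b) : ∃ v, ∀ a ∈ A, b a = π a v - v := by
  have : ProperSpace V := FiniteDimensional.proper ℂ V
  have : CompleteSpace V := FiniteDimensional.complete ℂ V
  have hzero : reducedRestriction A π = 0 := by
    by_contra hne
    obtain ⟨v, hv, hfix⟩ := hA V π hne
    exact hv (hinv v hfix)
  have h := LinearMap.congr_fun hzero (Submodule.Quotient.mk ⟨b, hb⟩)
  replace h : restrictCocycle A π ⟨b, hb⟩ ∈ (coboundaries (restrictRep A π)).topologicalClosure :=
    (Submodule.Quotient.mk_eq_zero _).1 h
  rw [(isClosed_coboundaries _).submodule_topologicalClosure_eq] at h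
  obtain ⟨v, hv⟩ := h
  exact ⟨v, fun a ha => hv ⟨a, ha⟩⟩

/-- A cocycle with values in the `A`-invariant vectors that grows sublinearly along generators of
`A` vanishes on `A`. -/
theorem IsCocycle.eq_zero_of_invariant {A : Subgroup G} {π : G →* (H ≃ₗᵢ[ℂ] H)} {b : G → H}
    (hb : IsCocycle π b) (hinv : ∀ g, b g ∈ invariants A π) {T : Set G}
    (hT : Subgroup.closure T = A)
    (hsub : ∀ t ∈ T, ∀ c : ℝ, 0 < c → ∃ᶠ n : ℕ in Filter.atTop, ‖b (t ^ n)‖ ≤ c * n) :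
    ∀ a ∈ A, b a = 0 := by
  have hTA : ∀ t ∈ T, t ∈ A := fun t ht => hT ▸ Subgroup.subset_closure ht
  intro a ha
  rw [← hT] at ha
  induction ha using Subgroup.closure_induction with
  | mem t ht =>
    refine eq_zero_of_frequently_mul_norm_le (M := 0) fun c hc => (hsub t ht c hc).mono fun n hn => ?_
    -- As `t` fixes `b t`, `b (t ^ n) = n • b t`.
    rw [hb.pow_eq (v := 0) (hinv t t (hTA t ht)) (by simp), map_zero, sub_zero, zero_add,
      ← Nat.cast_smul_eq_nsmul ℂ, norm_smul, Complex.norm_natCast] at hn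
    rwa [add_zero]
  | one => exact hb.map_one
  | mul x y _ _ hx hy => rw [hb, hx, hy, map_zero, add_zero]
  | inv x _ hx => rw [hb.map_inv, hx, map_zero, neg_zero]

theorem IsCocycle.exists_eq_sub_of_weakRelativeHT {A : Subgroup G} (hnormal : A.Normal)
    (hA : HasWeakRelativeHT A) {V : Type} [NormedAddCommGroup V] [InnerProductSpace ℂ V]
    [FiniteDimensional ℂ V] {π : G →* (V ≃ₗᵢ[ℂ] V)} {b : G → V} (hb : IsCocycle π b) {T : Set G}
    (hT : Subgroup.closure T = A)
    (hsub : ∀ t ∈ T, ∀ c : ℝ, 0 < c → ∃ᶠ n : ℕ in Filter.atTop, ‖b (t ^ n)‖ ≤ c * n) :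
    ∃ v, ∀ a ∈ A, b a = π a v - v := by
  set W := invariants A π
  have hW : ∀ g, ∀ v ∈ W, π g v ∈ W := fun g v hv => map_mem_invariants hnormal π g hv
  have hW' : ∀ g, ∀ v ∈ Wᗮ, π g v ∈ Wᗮ := fun g v hv => map_mem_orthogonal hW g hv
  choose p hp q hq hpq using fun g => W.exists_add_mem_mem_orthogonal (b g)
  -- The defects of the two cocycle identities are opposite vectors, one in `W` and one in `Wᗮ`, so
  -- both vanish.
  have hsplit : ∀ g h, p (g * h) = p g + π g (p h) ∧ q (g * h) = q g + π g (q h) := by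
    intro g h
    have hsum : p (g * h) - (p g + π g (p h)) = (q g + π g (q h)) - q (g * h) := by
      have := hb g h
      rw [hpq, hpq g, hpq h, map_add] at this
      rw [sub_eq_sub_iff_add_eq_add, this]
      abel
    have h1 : p (g * h) - (p g + π g (p h)) ∈ W :=
      W.sub_mem (hp _) (W.add_mem (hp _) (hW _ _ (hp _)))
    have h2 : (q g + π g (q h)) - q (g * h) ∈ Wᗮ :=
      Wᗮ.sub_mem (Wᗮ.add_mem (hq _) (hW' _ _ (hq _))) (hq _)
    have h0 : p (g * h) - (p g + π g (p h)) = 0 :=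
      W.isOrtho_orthogonal_right.disjoint.le_bot ⟨h1, hsum ▸ h2⟩
    exact ⟨sub_eq_zero.1 h0, (sub_eq_zero.1 (hsum.symm.trans h0)).symm⟩
  have hple : ∀ g, ‖p g‖ ≤ ‖b g‖ := fun g => by
    have h := norm_add_sq_eq_norm_sq_add_norm_sq_of_inner_eq_zero (𝕜 := ℂ) _ _ (hq g (p g) (hp g))
    rw [← hpq] at h
    nlinarith [norm_nonneg (p g), norm_nonneg (b g), norm_nonneg (q g)]
  have hpA : ∀ a ∈ A, p a = 0 :=
    IsCocycle.eq_zero_of_invariant (π := π) (fun g h => (hsplit g h).1) hp hT fun t ht c hc =>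
      (hsub t ht c hc).mono fun n hn => (hple _).trans hn
  -- An `A`-invariant vector of `Wᗮ` lies in `W ∩ Wᗮ = 0`.
  obtain ⟨v, hv⟩ := hA.exists_eq_sub (subRep Wᗮ π hW')
    (fun v hv => Subtype.ext (W.isOrtho_orthogonal_right.disjoint.le_bot
      ⟨fun a ha => congrArg Subtype.val (hv a ha), v.2⟩))
    (b := fun g => ⟨q g, hq g⟩) (fun g h => Subtype.ext (hsplit g h).2)
  refine ⟨v, fun a ha => ?_⟩
  rw [hpq, hpA a ha, zero_add]
  exact congrArg Subtype.val (hv a ha)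

end Invariants

/-! ### Complexification of orthogonal representations; the second condition. -/

section Complexification

variable {n : ℕ}

/-- The inclusion of `ℝⁿ` into `ℂⁿ`. -/
noncomputable def toComplex (x : EuclideanSpace ℝ (Fin n)) : EuclideanSpace ℂ (Fin n) :=
  WithLp.toLp 2 fun i => (x i : ℂ)

/-- The real part of a vector in `ℂⁿ`. -/
noncomputable def rePart (z : EuclideanSpace ℂ (Fin n)) : EuclideanSpace ℝ (Fin n) :=
  WithLp.toLp 2 fun i => (z i).re

/-- The imaginary part of a vector in `ℂⁿ`. -/
noncomputable def imPart (z : EuclideanSpace ℂ (Fin n)) : EuclideanSpace ℝ (Fin n) :=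
  WithLp.toLp 2 fun i => (z i).im

/-- The vector in `ℂⁿ` with given real and imaginary part. -/
noncomputable def ofReIm (x y : EuclideanSpace ℝ (Fin n)) : EuclideanSpace ℂ (Fin n) :=
  WithLp.toLp 2 fun i => ⟨x i, y i⟩

theorem norm_sq_ofReIm (x y : EuclideanSpace ℝ (Fin n)) :
    ‖ofReIm x y‖ ^ 2 = ‖x‖ ^ 2 + ‖y‖ ^ 2 := by
  simp only [EuclideanSpace.norm_sq_eq, ← Finset.sum_add_distrib]
  refine Finset.sum_congr rfl fun i _ => ?_
  rw [Complex.sq_norm, Complex.normSq_apply, Real.norm_eq_abs, Real.norm_eq_abs, sq_abs, sq_abs]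
  show x i * x i + y i * y i = _
  ring

theorem ofReIm_rePart_imPart (z : EuclideanSpace ℂ (Fin n)) :
    ofReIm (rePart z) (imPart z) = z := rfl

/-- The complexification of a linear isometry. -/
noncomputable def complexify (U : EuclideanSpace ℝ (Fin n) ≃ₗᵢ[ℝ] EuclideanSpace ℝ (Fin n)) :
    EuclideanSpace ℂ (Fin n) ≃ₗᵢ[ℂ] EuclideanSpace ℂ (Fin n) where
  toFun z := ofReIm (U (rePart z)) (U (imPart z))
  invFun z := ofReIm (U.symm (rePart z)) (U.symm (imPart z))
  map_add' z w := by
    have h1 : rePart (z + w) = rePart z + rePart w := rfl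
    have h2 : imPart (z + w) = imPart z + imPart w := rfl
    rw [h1, h2, map_add, map_add]
    rfl
  map_smul' c z := by
    have h1 : rePart (c • z) = c.re • rePart z - c.im • imPart z := rfl
    have h2 : imPart (c • z) = c.re • imPart z + c.im • rePart z := rfl
    rw [h1, h2, map_sub, map_add, map_smul, map_smul, map_smul, map_smul]
    rfl
  left_inv z := by
    show ofReIm (U.symm (U (rePart z))) (U.symm (U (imPart z))) = z
    rw [U.symm_apply_apply, U.symm_apply_apply]
    rfl
  right_inv z := by
    show ofReIm (U (U.symm (rePart z))) (U (U.symm (imPart z))) = z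
    rw [U.apply_symm_apply, U.apply_symm_apply]
    rfl
  norm_map' z := by
    show ‖ofReIm (U (rePart z)) (U (imPart z))‖ = ‖z‖
    rw [← sq_eq_sq₀ (norm_nonneg _) (norm_nonneg _), norm_sq_ofReIm, U.norm_map, U.norm_map,
      ← norm_sq_ofReIm, ofReIm_rePart_imPart]

theorem complexify_apply (U : EuclideanSpace ℝ (Fin n) ≃ₗᵢ[ℝ] EuclideanSpace ℝ (Fin n))
    (z : EuclideanSpace ℂ (Fin n)) :
    complexify U z = ofReIm (U (rePart z)) (U (imPart z)) := rfl

/-- The complexification of an orthogonal representation. -/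
noncomputable def complexifyRep {G : Type*} [Group G]
    (π : G →* (EuclideanSpace ℝ (Fin n) ≃ₗᵢ[ℝ] EuclideanSpace ℝ (Fin n))) :
    G →* (EuclideanSpace ℂ (Fin n) ≃ₗᵢ[ℂ] EuclideanSpace ℂ (Fin n)) :=
  MonoidHom.mk' (fun g => complexify (π g)) fun g h => by
    rw [map_mul]
    rfl

end Complexification

theorem hasRelativeFE_of_weakRelativeHT {G : Type*} [Group G] {S : Set G} (hfin : S.Finite)
    (hS : Subgroup.closure S = ⊤) {A : Subgroup G} (hnormal : A.Normal) (hHT : HasWeakRelativeHT A)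
    (hA : GeneratedByDistorted S A) : HasRelativeFE A := by
  obtain ⟨T, hdist, hT⟩ := hA
  intro n α
  have hb : IsCocycle (complexifyRep (linearPart α)) fun g => toComplex (α g 0) := fun g h => by
    show toComplex (α (g * h) 0) = toComplex (α g 0) + complexify _ (toComplex (α h 0))
    have hre : rePart (toComplex (α h 0)) = α h 0 := rfl
    have him : imPart (toComplex (α h 0)) = 0 := rfl
    have hgh : α (g * h) 0 = α g 0 + linearPart α g (α h 0) := isCocycle_orbit α g h
    rw [hgh, complexify_apply, hre, him, LinearIsometryEquiv.map_zero]
    ext i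
    simp [toComplex, ofReIm, Complex.ext_iff]
  obtain ⟨v, hv⟩ := hb.exists_eq_sub_of_weakRelativeHT hnormal hHT hT fun t ht c hc =>
    hb.frequently_norm_pow_le hfin hS (hdist t ht) hc
  -- `complexify` commutes with real parts and the cocycle is real, so `Re v` already trivialises it
  -- on `A`; the sign comes from `b a = π a v - v`.
  refine ⟨-rePart v, fun a ha => ?_⟩
  have h : α a 0 = linearPart α a (rePart v) - rePart v := congrArg rePart (hv a ha)
  rw [action_apply, h, map_neg]
  abel

end RelFE

theorem mainTheorem7 {G : Type*} [Group G] (S : Set G) (hSfin : S.Finite)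
    (hSgen : Subgroup.closure S = ⊤) (A : Subgroup G) :
    (RelFE.BoundedlyGeneratedByDistorted S A → RelFE.HasRelativeFE A) ∧
    (A.Normal → RelFE.HasWeakRelativeHT A → RelFE.GeneratedByDistorted S A →
      RelFE.HasRelativeFE A) :=
  ⟨RelFE.hasRelativeFE_of_boundedlyGeneratedByDistorted hSfin hSgen,
    RelFE.hasRelativeFE_of_weakRelativeHT hSfin hSgen⟩
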